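/- Let $M,N\ge 1$ be integers, $\tau_p>0$, $\nu_p=1/\tau_p$, $T=N\tau_p$, $B=M\nu_p$, $\alpha_\tau,\alpha_\nu,N_0>0$, and $\mathrm{sinc}(x)=\frac{\sin \pi x}{\pi x}$. The Gaussian-sinc (GS) filter is $w_{\mathrm{tx}}(\tau,\nu)=w_1(\tau)w_2(\nu)$ with $$w_1(\tau)=\Omega_\tau\sqrt B\,\mathrm{sinc}(B\tau)e^{-\alpha_\tau B^2\tau^2},\qquad w_2(\nu)=\Omega_\nu\sqrt T\,\mathrm{sinc}(T\nu)e^{-\alpha_\nu T^2\nu^2},$$ where $\Omega_\tau,\Omega_\nu>0$ are such that $\int|w_1|^2=\int|w_2|^2=1$; the matched receive filter is $w_{\mathrm{rx}}(\tau,\nu)=w_{\mathrm{tx}}^*(-\tau,-\nu)e^{j2\pi\nu\tau}$. Let $n(t)$ be (real or complex) zero-mean white Gaussian noise with $\mathbb E[n(t)n^*(s)]=N_0\delta(t-s)$, understood as a generalized random process, let $n_{\mathrm{dd}}(\tau,\nu)=\sqrt{\tau_p}\sum_{k\in\mathbb Z}n(\tau+k\tau_p)e^{-j2\pi\nu k\tau_p}$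 be its Zak transform, and let $$n_{\mathrm{dd}}[k,l]=(w_{\mathrm{rx}}*_\sigma n_{\mathrm{dd}})\Big(\tfrac{k\tau_p}{M},\tfrac{l\nu_p}{N}\Big),\qquad (a*_\sigma b)(\tau,\nu)=\iint a(\tau',\nu')b(\tau-\tau',\nu-\nu')e^{j2\pi\nu'(\tau-\tau')}\,d\tau'd\nu' .$$ Then for all $0\le k_1,k_2\le M-1$ and $0\le l_1,l_2\le N-1$ the $(k_1N+l_1+1,\,k_2N+l_2+1)$-th element of the covariance matrix of the noise vector, whose $(kN+l+1)$-th entry is $n_{\mathrm{dd}}[k,l]$, is $$\mathbb E\big[n_{\mathrm{dd}}[k_1,l_1]\,n_{\mathrm{dd}}^*[k_2,l_2]\big]=\tau_p\sum_{q_1\in\mathbb Z}\sum_{q_2\in\mathbb Z}e^{j2\pi\frac{q_2l_2-q_1l_1}{N}}\,g\Big(\tfrac{k_1\tau_p}{M}+q_1\tau_p\Big)g^*\Big(\tfrac{k_2\tau_p}{M}+q_2\tau_p\Big)\Big(S^{(1)}(x)\mathbb 1_{\{x\ne0\}}+S^{(2)}\mathbb 1_{\{x=0\}}\Big),$$ the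 double series being absolutely convergent, where $x=\frac{k_2-k_1}{M}\tau_p+(q_2-q_1)\tau_p$ and, with $\mathrm{erf}(z)=\frac{2}{\sqrt\pi}\int_0^z e^{-w^2}dw$ for $z\in\mathbb C$ and $a_1=\frac{\pi^2}{2\alpha_\tau B^2}$, $$g(u)=\frac{\Omega_\nu}{2\sqrt T}\Big(\mathrm{erf}\Big(\sqrt{\tfrac{\pi^2}{\alpha_\nu T^2}}\big(u+\tfrac T2\big)\Big)-\mathrm{erf}\Big(\sqrt{\tfrac{\pi^2}{\alpha_\nu T^2}}\big(u-\tfrac T2\big)\Big)\Big),$$ $$f_1(a,r,s,z)=\frac{e^{-z^2/(4a)}\sqrt\pi}{2\sqrt a}\Big[\mathrm{erf}\Big(\sqrt a\big(r+\tfrac{jz}{2a}\big)\Big)-\mathrm{erf}\Big(\sqrt a\big(s+\tfrac{jz}{2a}\big)\Big)\Big],$$ $$S^{(1)}(x)=N_0\Omega_\tau^2\sqrt{\tfrac{\pi}{2\alpha_\tau}}\,\frac{e^{-\alpha_\tau B^2x^2/2}}{j2\pi xB^2}\Big[e^{j\pi Bx}f_1(a_1,B,0,\pi x)-e^{-j\pi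 Bx}f_1(a_1,B,0,-\pi x)+e^{j\pi Bx}f_1(a_1,0,-B,-\pi x)-e^{-j\pi Bx}f_1(a_1,0,-B,\pi x)\Big],$$ $$S^{(2)}=N_0\Omega_\tau^2\sqrt{\tfrac{\pi}{2\alpha_\tau}}\,\frac1{B^2}\Big[2B\,\frac{\sqrt\pi}{2\sqrt{a_1}}\mathrm{erf}(\sqrt{a_1}B)-\frac1{a_1}\big(1-e^{-a_1B^2}\big)\Big].$$ -/

import Mathlib

open MeasureTheory ProbabilityTheory Complex
open scoped ComplexConjugate

noncomputable section

namespace ZakOTFS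

/-! ### Elementary functions -/

/-- The normalized sinc function `sin (π x) / (π x)`, with value `1` at `0`. -/
def nsinc (x : ℝ) : ℝ := Real.sinc (Real.pi * x)

/-- The error function on the complex plane, `erf z = (2 / √π) ∫_0^z exp (-w ^ 2) dw`, the integral
being taken along the segment `w = t z`, `0 ≤ t ≤ 1` (the integrand is entire). -/
def erf (z : ℂ) : ℂ :=
  (2 / (Real.sqrt Real.pi : ℂ)) * ∫ t in (0 : ℝ)..1, z * Complex.exp (-((t : ℂ) * z) ^ 2)

/-- `e(x) = exp (j 2 π x)`. -/
def cis (x : ℝ) : ℂ := Complex.exp (2 * Real.pi * I * x)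

/-! ### Delay-Doppler operations -/

/-- The time-Zak transform of an ordinary signal `a` is
`(Z a)(τ, ν) = √τp * ∑_k a (τ + k τp) e(-ν k τp)`.  For a test function `Φ(τ, ν)` one has
`∬ (Z a)(τ, ν) Φ(τ, ν) dτ dν = ∫ a(t) (Zᵗ Φ)(t) dt` with the transpose `Zᵗ` below.  The Zak transform
of a generalized signal `n` is therefore the generalized function `Φ ↦ n (Zᵗ Φ)`. -/
def zakTranspose (τp : ℝ) (Φ : ℝ → ℝ → ℂ) (t : ℝ) : ℂ :=
  (Real.sqrt τp : ℂ) * ∑' k : ℤ, ∫ ν : ℝ, Φ (t - k * τp) ν * cis (-(ν * k * τp))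

/-- The twisted convolution
`(w *σ u)(τ, ν) = ∬ w(τ', ν') u(τ - τ', ν - ν') e(ν' (τ - τ')) dτ' dν'`
is `∬ u(s, μ) Φ(s, μ) ds dμ` for the kernel `Φ` below (`s = τ - τ'`, `μ = ν - ν'`).  For a generalized
function `u`, the value at `(τ, ν)` is therefore `u` applied to this kernel. -/
def twistedKernel (w : ℝ → ℝ → ℂ) (τ ν : ℝ) (s μ : ℝ) : ℂ :=
  w (τ - s) (ν - μ) * cis ((ν - μ) * s)

/-- The filter matched to `w`: `w_rx(τ, ν) = conj (w(-τ, -ν)) e(ν τ)`. -/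
def matchedFilter (w : ℝ → ℝ → ℂ) (τ ν : ℝ) : ℂ := conj (w (-τ) (-ν)) * cis (ν * τ)

/-! ### White noise -/

/-- White Gaussian noise of spectral density `N₀` on the real line, as a generalized (complex) Gaussian
process: `n φ` is the random variable `∫ n(t) φ(t) dt`, for square-integrable `φ`.  The process is
linear in `φ`, jointly Gaussian, centred, and satisfies `E[n(t) conj (n(s))] = N₀ δ(t - s)`, i.e.
`E[n φ * conj (n ψ)] = N₀ ∫ φ(t) conj (ψ(t)) dt`.  Real noise and circularly symmetric complex
noise are both covered. -/
structure IsWhiteNoise {Ω : Type*} [MeasurableSpace Ω] (P : Measure Ω) (N₀ : ℝ)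
    (n : (ℝ → ℂ) → Ω → ℂ) : Prop where
  gaussian : IsGaussianProcess (fun φ : {φ : ℝ → ℂ // MemLp φ 2 volume} => n φ.1) P
  linear : ∀ (a b : ℂ) (φ ψ : ℝ → ℂ), MemLp φ 2 volume → MemLp ψ 2 volume →
    n (fun t => a * φ t + b * ψ t) =ᵐ[P] fun ω => a * n φ ω + b * n ψ ω
  mean : ∀ φ : ℝ → ℂ, MemLp φ 2 volume → ∫ ω, n φ ω ∂P = 0
  cov : ∀ φ ψ : ℝ → ℂ, MemLp φ 2 volume → MemLp ψ 2 volume →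
    ∫ ω, n φ ω * conj (n ψ ω) ∂P = (N₀ : ℂ) * ∫ t : ℝ, φ t * conj (ψ t)

/-! ### The Gaussian-sinc filter and the sampled filtered noise -/

/-- The parameters of the system. -/
structure Params where
  /-- number of delay bins -/
  M : ℕ
  /-- number of Doppler bins -/
  N : ℕ
  /-- delay period -/
  τp : ℝ
  /-- shape parameter of the delay pulse -/
  ατ : ℝ
  /-- shape parameter of the Doppler pulse -/
  αν : ℝ
  /-- energy normalization of the delay pulse -/
  Ωτ : ℝ
  /-- energy normalization of the Doppler pulse -/
  Ων : ℝ
  /-- spectral density of the noise -/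
  N₀ : ℝ

namespace Params

variable (p : Params)

/-- Doppler period. -/
def νp : ℝ := 1 / p.τp

/-- Frame duration. -/
def T : ℝ := p.N * p.τp

/-- Bandwidth. -/
def B : ℝ := p.M * p.νp

/-- Delay pulse. -/
def w₁ (τ : ℝ) : ℝ :=
  p.Ωτ * Real.sqrt p.B * nsinc (p.B * τ) * Real.exp (-(p.ατ * p.B ^ 2 * τ ^ 2))

/-- Doppler pulse. -/
def w₂ (ν : ℝ) : ℝ :=
  p.Ων * Real.sqrt p.T * nsinc (p.T * ν) * Real.exp (-(p.αν * p.T ^ 2 * ν ^ 2))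

/-- The Gaussian-sinc transmit filter. -/
def wtx (τ ν : ℝ) : ℂ := (p.w₁ τ : ℂ) * (p.w₂ ν : ℂ)

/-- The matched receive filter. -/
def wrx : ℝ → ℝ → ℂ := matchedFilter p.wtx

/-- The filtered delay-Doppler noise `w_rx *σ (Z n)` at the point `(τ, ν)`. -/
def filteredNoise {Ω : Type*} (n : (ℝ → ℂ) → Ω → ℂ) (τ ν : ℝ) : Ω → ℂ :=
  n (zakTranspose p.τp (twistedKernel p.wrx τ ν))

/-- The noise samples `n_dd[k, l]` on the information lattice. -/
def ndd {Ω : Type*} (n : (ℝ → ℂ) → Ω → ℂ) (k l : ℤ) : Ω → ℂ :=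
  p.filteredNoise n (k * p.τp / p.M) (l * p.νp / p.N)

/-- The noise vector; its entry number `k N + l` (counted from `0`) is `n_dd[k, l]`. -/
def noiseVector {Ω : Type*} (n : (ℝ → ℂ) → Ω → ℂ) (i : Fin (p.M * p.N)) : Ω → ℂ :=
  p.ndd n ((finProdFinEquiv.symm i).1 : ℕ) ((finProdFinEquiv.symm i).2 : ℕ)

/-- The noise covariance matrix `E[𝐧 𝐧ᴴ]`. -/
def noiseCov {Ω : Type*} [MeasurableSpace Ω] (P : Measure Ω) (n : (ℝ → ℂ) → Ω → ℂ) :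
    Matrix (Fin (p.M * p.N)) (Fin (p.M * p.N)) ℂ :=
  Matrix.of fun i j => ∫ ω, p.noiseVector n i ω * conj (p.noiseVector n j ω) ∂P

/-! ### The closed-form expressions -/

/-- The function `g`. -/
def g (u : ℝ) : ℂ :=
  (p.Ων : ℂ) / (2 * (Real.sqrt p.T : ℂ)) *
    (erf ((Real.sqrt (Real.pi ^ 2 / (p.αν * p.T ^ 2)) * (u + p.T / 2) : ℝ) : ℂ)
      - erf ((Real.sqrt (Real.pi ^ 2 / (p.αν * p.T ^ 2)) * (u - p.T / 2) : ℝ) : ℂ))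

/-- `x_{k₁, k₂, q₁, q₂}`. -/
def x (k₁ k₂ q₁ q₂ : ℤ) : ℝ :=
  ((k₂ : ℝ) - k₁) / p.M * p.τp + ((q₂ : ℝ) - q₁) * p.τp

/-- `f₁(a, x, y, z)`, a closed form of `∫_y^x exp (-a s ^ 2 - j z s) ds`. -/
def f₁ (a x y z : ℝ) : ℂ :=
  ((Real.exp (-(z ^ 2 / (4 * a))) * Real.sqrt Real.pi / (2 * Real.sqrt a) : ℝ) : ℂ) *
    (erf ((Real.sqrt a : ℂ) * ((x : ℂ) + I * z / (2 * a)))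
      - erf ((Real.sqrt a : ℂ) * ((y : ℂ) + I * z / (2 * a))))

/-- `a₁ = π² / (2 α_τ B²)`. -/
def a₁ : ℝ := Real.pi ^ 2 / (2 * p.ατ * p.B ^ 2)

/-- The prefactor `C_{3,1}(x)`. -/
def C₃₁ (x : ℝ) : ℂ :=
  (p.N₀ : ℂ) * (p.Ωτ : ℂ) ^ 2 * (Real.sqrt (Real.pi / (2 * p.ατ)) : ℂ) *
    ((Real.exp (-(p.ατ * p.B ^ 2 / 2 * x ^ 2)) : ℂ) / (I * 2 * Real.pi * x * (p.B : ℂ) ^ 2))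

/-- The factor `S⁽¹⁾`, as a function of `x ≠ 0`. -/
def S₁ (x : ℝ) : ℂ :=
  p.C₃₁ x *
    (Complex.exp (I * Real.pi * p.B * x) * f₁ p.a₁ p.B 0 (Real.pi * x)
      - Complex.exp (-(I * Real.pi * p.B * x)) * f₁ p.a₁ p.B 0 (-(Real.pi * x))
      + Complex.exp (I * Real.pi * p.B * x) * f₁ p.a₁ 0 (-p.B) (-(Real.pi * x))
      - Complex.exp (-(I * Real.pi * p.B * x)) * f₁ p.a₁ 0 (-p.B) (Real.pi * x))

/-- The prefactor `C_{3,2}`. -/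
def C₃₂ : ℝ := p.N₀ * p.Ωτ ^ 2 * Real.sqrt (Real.pi / (2 * p.ατ)) * (1 / p.B ^ 2)

/-- The constant `S⁽²⁾`. -/
def S₂ : ℂ :=
  (p.C₃₂ : ℂ) *
    ((p.B : ℂ) * ((Real.sqrt Real.pi / (2 * Real.sqrt p.a₁) : ℝ) * erf (Real.sqrt p.a₁ * p.B : ℝ))
      - ((1 / (2 * p.a₁) * (1 - Real.exp (-(p.a₁ * p.B ^ 2))) : ℝ) : ℂ)
      + (p.B : ℂ) * ((Real.sqrt Real.pi / (2 * Real.sqrt p.a₁) : ℝ) * erf (Real.sqrt p.a₁ * p.B : ℝ))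
      + ((1 / (2 * p.a₁) * (Real.exp (-(p.a₁ * p.B ^ 2)) - 1) : ℝ) : ℂ))

/-- The `(q₁, q₂)` term of the double series, including the factor `τp`. -/
def covTerm (k₁ l₁ k₂ l₂ : ℤ) (q : ℤ × ℤ) : ℂ :=
  (p.τp : ℂ) *
    (cis (((q.2 : ℝ) * l₂ - q.1 * l₁) / p.N) *
      p.g (k₁ * p.τp / p.M + q.1 * p.τp) * conj (p.g (k₂ * p.τp / p.M + q.2 * p.τp)) *
      (if p.x k₁ k₂ q.1 q.2 ≠ 0 then p.S₁ (p.x k₁ k₂ q.1 q.2) else p.S₂))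

end Params

end ZakOTFS

end

/-!
The white noise enters a sample of the filtered delay-Doppler noise only through the test function
`φ = zakTranspose τp (twistedKernel w_rx τ ν)`.  In this kernel the phases of the matched filter and of
the twisted convolution combine so that the Doppler integral is the inverse Fourier transform of
the Doppler pulse, which is `g` (`Params.integral_w₂_mul_cis`: a box convolved with a Gaussian).
Hence (`Params.zakTranspose_twistedKernel_wrx`)
`φ(t) = √τp ∑_q e(-ν q τp) g(τ + q τp) w₁(τ + q τp - t)`.
As `g` decays like a Gaussian (`Params.summable_norm_g`) and `w₁` is bounded and integrable, `φ` is
square-integrable, and the covariance `N₀ ∫ φ₁ conj φ₂` may be expanded termwise into an absolutely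
convergent double series (`hasSum_integral_pulseTrain_mul_conj`).  Its terms contain the
autocorrelation of `w₁` at the lag `x`.

The autocorrelation is computed from the fact that
`sinc(B(s - x/2)) sinc(B(s + x/2))` is, for `s ≠ ± x/2`, the cosine transform of
`2 B⁻² (B - h) sinc(x (B - h))` on `0 ≤ h ≤ B`, with the normalized sinc
throughout (`nsinc_mul_nsinc`).  Integrating against the Gaussian
in `s` leaves the integral `Params.lagIntegral` over `h`, and completing the square expresses it
through `erf` at complex points, giving `S₁` for `x ≠ 0` and `S₂` for `x = 0`
(`Params.S_eq_autocorrelation`).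
-/

namespace ZakOTFS

/-! ### The error function and Gaussian integrals -/

/-- The entire function `exp (-z ^ 2)` has a primitive, and `erf` is obtained from it by integrating
along segments. -/
theorem hasDerivAt_erf (z : ℂ) :
    HasDerivAt erf (2 / (Real.sqrt Real.pi : ℂ) * Complex.exp (-z ^ 2)) z := by
  obtain ⟨G, hG⟩ := Differentiable.isExactOn_univ
    (f := fun z : ℂ => Complex.exp (-z ^ 2)) (by fun_prop)
  have key : erf = fun z => (2 / (Real.sqrt Real.pi : ℂ)) * (G z - G 0) := by
    funext z
    have hd : ∀ t ∈ Set.uIcc (0 : ℝ) 1,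
        HasDerivAt (fun t : ℝ => G (t * z)) (z * Complex.exp (-((t : ℂ) * z) ^ 2)) t := by
      intro t _
      have h1 : HasDerivAt (fun t : ℝ => (t : ℂ) * z) z t := by
        simpa using (Complex.ofRealCLM.hasDerivAt (x := t)).mul_const z
      have := (hG (t * z) trivial).comp t h1
      rw [mul_comm]
      exact this
    rw [erf, intervalIntegral.integral_eq_sub_of_hasDerivAt hd
      (Continuous.intervalIntegrable (by fun_prop) _ _)]
    simp
  rw [key]
  exact ((hG z trivial).sub_const _).const_mul _

theorem erf_sub_erf (c w : ℂ) (x y : ℝ) :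
    erf (c * (x + w)) - erf (c * (y + w)) =
      2 / (Real.sqrt Real.pi : ℂ) * (c * ∫ s in y..x, Complex.exp (-(c * (s + w)) ^ 2)) := by
  have hd : ∀ s ∈ Set.uIcc y x, HasDerivAt (fun s : ℝ => erf (c * (s + w)))
      (2 / (Real.sqrt Real.pi : ℂ) * (c * Complex.exp (-(c * (s + w)) ^ 2))) s := by
    intro s _
    have h1 : HasDerivAt (fun s : ℝ => c * ((s : ℂ) + w)) c s := by
      simpa using ((Complex.ofRealCLM.hasDerivAt (x := s)).add_const w).const_mul c
    have := (hasDerivAt_erf (c * (s + w))).comp s h1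
    convert! this using 1
    ring
  rw [← intervalIntegral.integral_const_mul, ← intervalIntegral.integral_const_mul,
    intervalIntegral.integral_eq_sub_of_hasDerivAt hd
      (Continuous.intervalIntegrable (by fun_prop) _ _)]

theorem erf_zero : erf 0 = 0 := by simp [erf]

/-- Completing the square turns the integral into a difference of values of `erf` at complex
points. -/
theorem f₁_eq_integral {a : ℝ} (ha : 0 < a) (x y z : ℝ) :
    Params.f₁ a x y z = ∫ s in y..x, Complex.exp (-(a * s ^ 2) - I * z * s) := by
  have hs : (Real.sqrt a : ℂ) ^ 2 = a := by
    rw [← Complex.ofReal_pow, Real.sq_sqrt ha.le]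
  have hs0 : (Real.sqrt a : ℂ) ≠ 0 := by
    exact_mod_cast (Real.sqrt_pos.2 ha).ne'
  have hp0 : (Real.sqrt Real.pi : ℂ) ≠ 0 := by
    exact_mod_cast (Real.sqrt_pos.2 Real.pi_pos).ne'
  have ha0 : (a : ℂ) ≠ 0 := by exact_mod_cast ha.ne'
  rw [Params.f₁, erf_sub_erf]
  have : ∀ s : ℝ, Complex.exp (-(a * s ^ 2) - I * z * s) = (Real.exp (-(z ^ 2 / (4 * a))) : ℂ) *
      Complex.exp (-((Real.sqrt a : ℂ) * (s + I * z / (2 * a))) ^ 2) := by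
    intro s
    rw [Complex.ofReal_exp, ← Complex.exp_add, mul_pow, hs]
    congr 1
    push_cast
    field_simp
    ring_nf
    simp only [Complex.I_sq]
    ring
  simp_rw [this]
  rw [intervalIntegral.integral_const_mul]
  push_cast
  field_simp

namespace Params

theorem B_pos {p : Params} (hM : 0 < p.M) (hτp : 0 < p.τp) : 0 < p.B := by
  have : (0 : ℝ) < p.M := by exact_mod_cast hM
  unfold B νp; positivity

theorem T_pos {p : Params} (hN : 0 < p.N) (hτp : 0 < p.τp) : 0 < p.T := by
  have : (0 : ℝ) < p.N := by exact_mod_cast hN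
  unfold T; positivity

/-- `g` is a Gaussian averaged over a window of width `T`; in particular it is real-valued. -/
theorem g_eq_integral {p : Params} (hT : 0 < p.T) (hαν : 0 < p.αν) (u : ℝ) :
    p.g u = ((p.Ων / Real.sqrt p.T * Real.sqrt (Real.pi / (p.αν * p.T ^ 2)) *
      ∫ v in (u - p.T / 2)..(u + p.T / 2),
        Real.exp (-(Real.pi ^ 2 / (p.αν * p.T ^ 2) * v ^ 2)) : ℝ) : ℂ) := by
  set b := Real.pi ^ 2 / (p.αν * p.T ^ 2) with hb
  have hb0 : 0 < b := by positivity
  have hc : Real.sqrt (Real.pi / (p.αν * p.T ^ 2)) = Real.sqrt b / Real.sqrt Real.pi := by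
    rw [← Real.sqrt_div hb0.le]
    congr 1
    rw [hb]; field_simp
  have h := erf_sub_erf (Real.sqrt b) 0 (u + p.T / 2) (u - p.T / 2)
  have h2 : ∀ s : ℝ, Complex.exp (-((Real.sqrt b : ℂ) * (s + 0)) ^ 2) =
      ((Real.exp (-(b * s ^ 2)) : ℝ) : ℂ) := by
    intro s
    rw [add_zero, mul_pow, ← Complex.ofReal_pow, Real.sq_sqrt hb0.le]
    push_cast; rfl
  simp_rw [h2] at h
  rw [intervalIntegral.integral_ofReal] at h
  rw [g, hc]
  simp only [add_zero] at h
  rw [Complex.ofReal_mul, Complex.ofReal_mul, h]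
  push_cast
  ring

theorem integral_gaussian_eq {a : ℝ} (ha : 0 < a) (x : ℝ) :
    ((Real.sqrt Real.pi / (2 * Real.sqrt a) : ℝ) : ℂ) * erf ((Real.sqrt a * x : ℝ) : ℂ) =
      ((∫ s in (0 : ℝ)..x, Real.exp (-(a * s ^ 2)) : ℝ) : ℂ) := by
  have h := f₁_eq_integral ha x 0 0
  rw [f₁] at h
  simp only [Complex.ofReal_zero, mul_zero, zero_div, add_zero, erf_zero, sub_zero, zero_mul] at h
  rw [← intervalIntegral.integral_ofReal]
  push_cast at h ⊢
  rw [← h]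
  simp

end Params

/-! ### Integral forms of the closed expressions, and decay of `g` -/

theorem mul_sinc_mul {b : ℝ} (hb : b ≠ 0) (y : ℝ) :
    y * Real.sinc (b * y) = Real.sin (b * y) / b := by
  rcases eq_or_ne y 0 with rfl | hy
  · simp
  · rw [Real.sinc_of_ne_zero (mul_ne_zero hb hy)]
    field_simp

theorem integral_id_mul_gaussian {a : ℝ} (ha : a ≠ 0) (b : ℝ) :
    ∫ h in (0 : ℝ)..b, h * Real.exp (-(a * h ^ 2)) =
      1 / (2 * a) * (1 - Real.exp (-(a * b ^ 2))) := by
  have hd : ∀ h ∈ Set.uIcc 0 b, HasDerivAt (fun h : ℝ => -(1 / (2 * a)) * Real.exp (-(a * h ^ 2)))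
      (h * Real.exp (-(a * h ^ 2))) h := by
    intro h _
    have h1 : HasDerivAt (fun h : ℝ => -(a * h ^ 2)) (-(a * (2 * h))) h := by
      simpa using ((hasDerivAt_pow 2 h).const_mul a).fun_neg
    convert! h1.exp.const_mul (-(1 / (2 * a))) using 1
    field_simp
  rw [intervalIntegral.integral_eq_sub_of_hasDerivAt hd
    (Continuous.intervalIntegrable (by fun_prop) _ _)]
  simp
  ring

theorem summable_exp_neg_mul_int_sq {b : ℝ} (hb : 0 < b) :
    Summable fun q : ℤ => Real.exp (-(b * (q : ℝ) ^ 2)) := by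
  refine Summable.of_norm_bounded_eventually
    (((Real.summable_one_div_int_pow (p := 2)).2 (by norm_num)).mul_left b⁻¹) ?_
  filter_upwards [(Set.finite_singleton (0 : ℤ)).compl_mem_cofinite] with q hq
  have hq0 : (q : ℝ) ≠ 0 := by exact_mod_cast hq
  have hpos : 0 < b * (q : ℝ) ^ 2 := by positivity
  rw [Real.norm_of_nonneg (Real.exp_pos _).le, Real.exp_neg, ← one_div b, div_mul_div_comm, one_mul,
    ← one_div]
  exact one_div_le_one_div_of_le hpos ((Real.add_one_le_exp _).trans' (by linarith))

namespace Params

variable (p : Params)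

/-- Reflection `s ↦ -s`: the two integrals over `[-B, 0]` in `S₁` repeat those over `[0, B]`. -/
theorem f₁_neg {a : ℝ} (ha : 0 < a) (b z : ℝ) : f₁ a 0 (-b) (-z) = f₁ a b 0 z := by
  rw [f₁_eq_integral ha, f₁_eq_integral ha]
  have h := intervalIntegral.integral_comp_neg (a := 0) (b := b)
    (fun s : ℝ => Complex.exp (-(a * s ^ 2) - I * (-z : ℝ) * s))
  rw [neg_zero] at h
  rw [← h]
  congr 1
  funext s
  push_cast
  ring_nf

/-- The integral `2 ∫_0^B exp (-a₁ h ^ 2) (B - h) sinc (π x (B - h)) dh`, which for `x ≠ 0` is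
`∫_{-B}^B exp (-a₁ h ^ 2) sin (π x (B - |h|)) / (π x) dh`.  Here `sinc y = sin y / y`.
It carries the dependence of the autocorrelation of the delay pulse on the lag `x`, up to a
Gaussian factor. -/
noncomputable def lagIntegral (x : ℝ) : ℝ :=
  2 * ∫ h in (0 : ℝ)..p.B,
    Real.exp (-(p.a₁ * h ^ 2)) * ((p.B - h) * Real.sinc (Real.pi * x * (p.B - h)))

variable {p}

theorem a₁_pos (hB : 0 < p.B) (hατ : 0 < p.ατ) : 0 < p.a₁ := by
  unfold a₁; positivity

theorem S₁_eq_lagIntegral (hB : 0 < p.B) (hατ : 0 < p.ατ) {x : ℝ} (hx : x ≠ 0) :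
    p.S₁ x = ((p.N₀ * (p.Ωτ ^ 2 * Real.sqrt (Real.pi / (2 * p.ατ)) / p.B ^ 2 *
      Real.exp (-(p.ατ * p.B ^ 2 / 2 * x ^ 2)) * p.lagIntegral x) : ℝ) : ℂ) := by
  have ha := a₁_pos hB hατ
  have h2 : f₁ p.a₁ 0 (-p.B) (Real.pi * x) = f₁ p.a₁ p.B 0 (-(Real.pi * x)) := by
    simpa using f₁_neg ha p.B (-(Real.pi * x))
  have hsum : Complex.exp (I * Real.pi * p.B * x) * f₁ p.a₁ p.B 0 (Real.pi * x)
      - Complex.exp (-(I * Real.pi * p.B * x)) * f₁ p.a₁ p.B 0 (-(Real.pi * x)) =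
      (I * Real.pi * x) * p.lagIntegral x := by
    rw [f₁_eq_integral ha, f₁_eq_integral ha, ← intervalIntegral.integral_const_mul,
      ← intervalIntegral.integral_const_mul, ← intervalIntegral.integral_sub
        (Continuous.intervalIntegrable (by fun_prop) _ _)
        (Continuous.intervalIntegrable (by fun_prop) _ _), lagIntegral,
      Complex.ofReal_mul 2, ← intervalIntegral.integral_ofReal, ← mul_assoc,
      ← intervalIntegral.integral_const_mul]
    congr 1
    funext h
    have hπx : Real.pi * x ≠ 0 := mul_ne_zero Real.pi_ne_zero hx
    rw [mul_sinc_mul hπx, ← Complex.exp_add, ← Complex.exp_add]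
    have e1 : I * Real.pi * p.B * x + (-(p.a₁ * h ^ 2) - I * (Real.pi * x : ℝ) * h) =
        -(p.a₁ * h ^ 2) + (Real.pi * x * (p.B - h) : ℝ) * I := by push_cast; ring
    have e2 : -(I * Real.pi * p.B * x) + (-(p.a₁ * h ^ 2) - I * (-(Real.pi * x) : ℝ) * h) =
        -(p.a₁ * h ^ 2) + (-(Real.pi * x * (p.B - h) : ℝ)) * I := by push_cast; ring
    rw [e1, e2, Complex.exp_add, Complex.exp_add, Complex.exp_mul_I, Complex.exp_mul_I,
      Complex.cos_neg, Complex.sin_neg]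
    have hπ : (Real.pi : ℂ) ≠ 0 := by exact_mod_cast Real.pi_ne_zero
    have hxc : (x : ℂ) ≠ 0 := by exact_mod_cast hx
    push_cast
    field_simp
    ring
  have hbr : ∀ A B C D : ℂ, A - B = C → A - B + A - B = 2 * C := by
    intro A B C D h; linear_combination 2 * h
  rw [S₁, f₁_neg ha, h2, hbr _ _ _ 0 hsum, C₃₁]
  have hπ : (Real.pi : ℂ) ≠ 0 := by exact_mod_cast Real.pi_ne_zero
  have hxc : (x : ℂ) ≠ 0 := by exact_mod_cast hx
  have hBc : (p.B : ℂ) ≠ 0 := by exact_mod_cast hB.ne'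
  push_cast
  field_simp [Complex.I_ne_zero]

theorem S₂_eq_lagIntegral (hB : 0 < p.B) (hατ : 0 < p.ατ) :
    p.S₂ = ((p.N₀ * (p.Ωτ ^ 2 * Real.sqrt (Real.pi / (2 * p.ατ)) / p.B ^ 2 *
      p.lagIntegral 0) : ℝ) : ℂ) := by
  have ha := a₁_pos hB hατ
  rw [S₂, integral_gaussian_eq ha]
  have : p.lagIntegral 0 = 2 * (p.B * ∫ s in (0 : ℝ)..p.B, Real.exp (-(p.a₁ * s ^ 2))) -
      2 * (1 / (2 * p.a₁) * (1 - Real.exp (-(p.a₁ * p.B ^ 2)))) := by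
    rw [← integral_id_mul_gaussian ha.ne', ← mul_sub, ← intervalIntegral.integral_const_mul,
      ← intervalIntegral.integral_sub
        (Continuous.intervalIntegrable (by fun_prop) _ _)
        (Continuous.intervalIntegrable (by fun_prop) _ _), lagIntegral]
    congr 2
    funext h
    simp
    ring
  rw [this, C₃₂]
  push_cast
  ring

/-- `g` decays like a Gaussian, which makes the double series absolutely convergent. -/
theorem summable_norm_g (hT : 0 < p.T) (hτp : 0 < p.τp) (hαν : 0 < p.αν) (τ : ℝ) :
    Summable fun q : ℤ => ‖p.g (τ + q * p.τp)‖ := by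
  set b := Real.pi ^ 2 / (p.αν * p.T ^ 2) with hb
  have hb0 : 0 < b := by positivity
  set C := p.Ων / Real.sqrt p.T * Real.sqrt (Real.pi / (p.αν * p.T ^ 2)) with hC
  refine Summable.of_nonneg_of_le (fun _ => norm_nonneg _) (fun q => ?_)
    ((summable_exp_neg_mul_int_sq (b := b * p.τp ^ 2 / 2) (by positivity)).mul_left
      (|C| * (Real.exp (b * (|τ| + p.T / 2) ^ 2) * p.T)))
  rw [g_eq_integral hT hαν, Complex.norm_real, norm_mul, Real.norm_eq_abs, mul_assoc |C|]
  refine mul_le_mul_of_nonneg_left ?_ (abs_nonneg _)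
  refine (intervalIntegral.norm_integral_le_of_norm_le_const
    (C := Real.exp (b * (|τ| + p.T / 2) ^ 2) *
      Real.exp (-(b * p.τp ^ 2 / 2 * (q : ℝ) ^ 2))) ?_).trans (le_of_eq ?_)
  · intro v hv
    rw [Set.uIoc_of_le (by linarith)] at hv
    rw [Real.norm_of_nonneg (Real.exp_pos _).le, ← Real.exp_add]
    refine Real.exp_le_exp.2 ?_
    -- with `d = v - q τp` one has `v ^ 2 ≥ (q τp) ^ 2 / 2 - d ^ 2` and `|d| ≤ |τ| + T / 2`
    have hd : (v - q * p.τp) ^ 2 ≤ (|τ| + p.T / 2) ^ 2 := by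
      rw [sq_le_sq, abs_of_nonneg (by positivity : 0 ≤ |τ| + p.T / 2)]
      have : v - q * p.τp = τ + (v - (τ + q * p.τp)) := by ring
      rw [this]
      refine (abs_add_le _ _).trans (add_le_add le_rfl (abs_le.2 ⟨?_, ?_⟩)) <;> linarith [hv.1, hv.2]
    have hv2 : (q * p.τp) ^ 2 / 2 - (v - q * p.τp) ^ 2 ≤ v ^ 2 := by
      nlinarith [sq_nonneg (v + (v - q * p.τp))]
    nlinarith [mul_le_mul_of_nonneg_left (hv2.trans' (sub_le_sub_left hd _)) hb0.le]
  · rw [show τ + q * p.τp + p.T / 2 - (τ + q * p.τp - p.T / 2) = p.T by ring, abs_of_pos hT]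
    ring

end Params

/-! ### Fourier transforms of the pulses -/

theorem nsinc_neg (x : ℝ) : nsinc (-x) = nsinc x := by
  simp [nsinc, Real.sinc_neg]

theorem continuous_nsinc : Continuous nsinc :=
  Real.continuous_sinc.comp (by fun_prop)

theorem abs_nsinc_le_one (x : ℝ) : |nsinc x| ≤ 1 := Real.abs_sinc_le_one _

theorem continuous_cis : Continuous cis := by unfold cis; fun_prop

theorem norm_cis (x : ℝ) : ‖cis x‖ = 1 := by
  rw [cis, show (2 * Real.pi * I * x : ℂ) = ((2 * Real.pi * x : ℝ) : ℂ) * I by push_cast; ring,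
    Complex.norm_exp_ofReal_mul_I]

theorem cis_add (x y : ℝ) : cis (x + y) = cis x * cis y := by
  rw [cis, cis, cis, ← Complex.exp_add]; congr 1; push_cast; ring

theorem cis_neg (x : ℝ) : cis (-x) = conj (cis x) := by
  rw [cis, cis, ← Complex.exp_conj]; congr 1
  simp only [map_mul, Complex.conj_ofReal, Complex.conj_I, map_ofNat, Complex.ofReal_neg]
  ring

/-- `cis (u y) sinc (T y)` is the inverse Fourier transform of the box of width `T`, height `1 / T`
and centre `u`. -/
theorem nsinc_mul_cis {T : ℝ} (hT : T ≠ 0) (u y : ℝ) :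
    (nsinc (T * y) : ℂ) * cis (y * u) =
      1 / T * ∫ v in (u - T / 2)..(u + T / 2), cis (y * v) := by
  have hTc : (T : ℂ) ≠ 0 := by exact_mod_cast hT
  rcases eq_or_ne y 0 with rfl | hy
  · simp [nsinc, cis]
    field_simp
  · have hyc : (y : ℂ) ≠ 0 := by exact_mod_cast hy
    have hπ : (Real.pi : ℂ) ≠ 0 := by exact_mod_cast Real.pi_ne_zero
    have hc : (2 * Real.pi * I * y : ℂ) ≠ 0 := by simp [hyc, hπ]
    have : ∀ v : ℝ, cis (y * v) = Complex.exp ((2 * Real.pi * I * y) * v) := by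
      intro v; rw [cis]; congr 1; push_cast; ring
    simp_rw [this]
    rw [integral_exp_mul_complex hc, nsinc,
      Real.sinc_of_ne_zero (by positivity)]
    have e1 : 2 * Real.pi * I * y * ((u + T / 2 : ℝ) : ℂ) =
      2 * Real.pi * I * y * u + (Real.pi * (T * y)) * I := by push_cast; ring
    have e2 : 2 * Real.pi * I * y * ((u - T / 2 : ℝ) : ℂ) =
      2 * Real.pi * I * y * u + (-(Real.pi * (T * y))) * I := by push_cast; ring
    rw [e1, e2, Complex.exp_add, Complex.exp_add, Complex.exp_mul_I, Complex.exp_mul_I,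
      Complex.cos_neg, Complex.sin_neg]
    push_cast
    field_simp [Complex.I_ne_zero]
    ring

theorem integral_cis_mul_gaussian {b : ℝ} (hb : 0 < b) (v : ℝ) :
    ∫ y : ℝ, cis (y * v) * (Real.exp (-(b * y ^ 2)) : ℂ) =
      ((Real.sqrt (Real.pi / b) * Real.exp (-(Real.pi ^ 2 / b * v ^ 2)) : ℝ) : ℂ) := by
  have h := fourierIntegral_gaussian (b := (b : ℂ)) (by simpa using hb) (2 * Real.pi * v)
  have e : (Real.pi / b : ℂ) ^ (1 / 2 : ℂ) = (Real.sqrt (Real.pi / b) : ℂ) := by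
    rw [Real.sqrt_eq_rpow, Complex.ofReal_cpow (by positivity)]
    push_cast; rfl
  rw [e] at h
  have hbc : (b : ℂ) ≠ 0 := by exact_mod_cast hb.ne'
  have l : ∀ y : ℝ, cis (y * v) * (Real.exp (-(b * y ^ 2)) : ℂ) =
      Complex.exp (I * (2 * Real.pi * v) * y) * Complex.exp (-b * y ^ 2) := by
    intro y
    rw [cis]; push_cast; congr 2 <;> ring
  simp_rw [l]
  rw [h]
  push_cast
  congr 2
  field_simp
  ring

theorem integral_cos_mul_gaussian {b : ℝ} (hb : 0 < b) (v : ℝ) :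
    ∫ y : ℝ, Real.cos (2 * Real.pi * y * v) * Real.exp (-(b * y ^ 2)) =
      Real.sqrt (Real.pi / b) * Real.exp (-(Real.pi ^ 2 / b * v ^ 2)) := by
  have h := congrArg Complex.re (integral_cis_mul_gaussian hb v)
  rw [Complex.ofReal_re] at h
  rw [← h]
  have hint : Integrable fun y : ℝ => cis (y * v) * (Real.exp (-(b * y ^ 2)) : ℂ) := by
    refine ((integrable_exp_neg_mul_sq hb).ofReal (𝕜 := ℂ)).mono ?_ (.of_forall fun y => ?_)
    · exact Continuous.aestronglyMeasurable ((continuous_cis.comp (by fun_prop)).mul (by fun_prop))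
    · simp [norm_cis]
  refine ((integral_re (𝕜 := ℂ) hint).symm.trans ?_).symm
  congr 1
  funext y
  rw [cis, show (2 * Real.pi * I * (y * v : ℝ) : ℂ) = ((2 * Real.pi * y * v : ℝ) : ℂ) * I by
    push_cast; ring]
  simp only [RCLike.re_eq_complex_re, Complex.re_mul_ofReal, Complex.exp_ofReal_mul_I_re]

namespace Params

variable {p : Params}

/-- The function `g` is the inverse Fourier transform of the Doppler pulse. -/
theorem integral_w₂_mul_cis (hT : 0 < p.T) (hαν : 0 < p.αν) (u : ℝ) :
    ∫ y : ℝ, (p.w₂ y : ℂ) * cis (y * u) = p.g u := by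
  set b := p.αν * p.T ^ 2 with hb
  have hb0 : 0 < b := by positivity
  have hpt : ∀ y : ℝ, (p.w₂ y : ℂ) * cis (y * u) = (p.Ων * Real.sqrt p.T / p.T : ℝ) *
      ∫ v in (u - p.T / 2)..(u + p.T / 2), cis (y * v) * (Real.exp (-(b * y ^ 2)) : ℂ) := by
    intro y
    rw [intervalIntegral.integral_mul_const]
    have := nsinc_mul_cis hT.ne' u y
    rw [w₂, ← hb]
    push_cast
    linear_combination ((p.Ων : ℂ) * Real.sqrt p.T * Complex.exp (-(b * y ^ 2))) * this
  simp_rw [hpt]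
  rw [integral_const_mul, ← intervalIntegral_integral_swap, g_eq_integral hT hαν]
  · simp_rw [integral_cis_mul_gaussian hb0]
    rw [intervalIntegral.integral_ofReal, intervalIntegral.integral_const_mul, ← Complex.ofReal_mul]
    congr 1
    have : Real.sqrt p.T / p.T = 1 / Real.sqrt p.T := by
      rw [Real.sqrt_div_self, one_div]
    rw [mul_div_assoc, this]
    ring
  · have h1 : Integrable (fun z : ℝ × ℝ => (1 : ℝ) * Real.exp (-b * z.2 ^ 2))
        ((volume.restrict (Set.uIoc (u - p.T / 2) (u + p.T / 2))).prod volume) :=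
      Integrable.mul_prod (f := fun _ : ℝ => (1 : ℝ))
        (integrableOn_const (by simp [Set.uIoc]))
        (integrable_exp_neg_mul_sq hb0)
    refine h1.mono ?_ (.of_forall fun z => ?_)
    · exact Continuous.aestronglyMeasurable ((continuous_cis.comp (by fun_prop)).mul (by fun_prop))
    · rw [Function.uncurry, norm_mul, norm_cis, one_mul, one_mul, Complex.norm_real, neg_mul]

end Params

/-! ### The autocorrelation of the delay pulse -/

/-- A product of two shifted sinc pulses is the cosine transform of a function supported
on `[0, B]`. -/
theorem nsinc_mul_nsinc {B : ℝ} (hB : 0 < B) {x s : ℝ} (h1 : s - x / 2 ≠ 0) (h2 : s + x / 2 ≠ 0) :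
    nsinc (B * (s - x / 2)) * nsinc (B * (s + x / 2)) =
      2 / B ^ 2 * ∫ h in (0 : ℝ)..B,
        Real.cos (2 * Real.pi * s * h) * ((B - h) * Real.sinc (Real.pi * x * (B - h))) := by
  have hπ := Real.pi_ne_zero
  rw [nsinc, nsinc, Real.sinc_of_ne_zero (by positivity), Real.sinc_of_ne_zero (by positivity)]
  rcases eq_or_ne x 0 with rfl | hx
  · have hs : s ≠ 0 := by simpa using h1
    have hd : ∀ h ∈ Set.uIcc 0 B, HasDerivAt
        (fun h : ℝ => (B - h) * Real.sin (2 * Real.pi * s * h) / (2 * Real.pi * s)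
          - Real.cos (2 * Real.pi * s * h) / (2 * Real.pi * s) ^ 2)
        (Real.cos (2 * Real.pi * s * h) * ((B - h) * Real.sinc (Real.pi * 0 * (B - h)))) h := by
      intro h _
      have hl : HasDerivAt (fun h : ℝ => 2 * Real.pi * s * h) (2 * Real.pi * s) h := by
        simpa using (hasDerivAt_id h).const_mul (2 * Real.pi * s)
      convert! ((((hasDerivAt_id h).const_sub B).mul hl.sin).div_const (2 * Real.pi * s)).sub
        (hl.cos.div_const ((2 * Real.pi * s) ^ 2)) using 1
      simp
      field_simp
      ring
    rw [intervalIntegral.integral_eq_sub_of_hasDerivAt hd (Continuous.intervalIntegrable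
      (by have := Real.continuous_sinc; fun_prop) _ _)]
    have e : 2 * Real.pi * s * B = 2 * (Real.pi * (B * s)) := by ring
    rw [e, Real.cos_two_mul, Real.cos_sq']
    simp
    field_simp
    ring
  · have hxπ : Real.pi * x ≠ 0 := mul_ne_zero hπ hx
    have hm : 2 * s - x ≠ 0 := fun h => h1 (by linarith)
    have hp : 2 * s + x ≠ 0 := fun h => h2 (by linarith)
    have hd : ∀ h ∈ Set.uIcc 0 B, HasDerivAt
        (fun h : ℝ => -(1 / (2 * (Real.pi * x))) *
          (Real.cos (Real.pi * x * B + Real.pi * (2 * s - x) * h) / (Real.pi * (2 * s - x))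
            - Real.cos (Real.pi * x * B - Real.pi * (2 * s + x) * h) / (Real.pi * (2 * s + x))))
        (Real.cos (2 * Real.pi * s * h) * ((B - h) * Real.sinc (Real.pi * x * (B - h)))) h := by
      intro h _
      have hl1 : HasDerivAt (fun h : ℝ => Real.pi * x * B + Real.pi * (2 * s - x) * h)
          (Real.pi * (2 * s - x)) h := by
        simpa using ((hasDerivAt_id h).const_mul (Real.pi * (2 * s - x))).const_add
          (Real.pi * x * B)
      have hl2 : HasDerivAt (fun h : ℝ => Real.pi * x * B - Real.pi * (2 * s + x) * h)
          (-(Real.pi * (2 * s + x))) h := by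
        simpa using ((hasDerivAt_id h).const_mul (Real.pi * (2 * s + x))).const_sub
          (Real.pi * x * B)
      convert! ((hl1.cos.div_const (Real.pi * (2 * s - x))).sub
        (hl2.cos.div_const (Real.pi * (2 * s + x)))).const_mul (-(1 / (2 * (Real.pi * x)))) using 1
      rw [mul_sinc_mul hxπ]
      have e1 : Real.pi * x * B + Real.pi * (2 * s - x) * h =
        Real.pi * x * (B - h) + 2 * Real.pi * s * h := by ring
      have e2 : Real.pi * x * B - Real.pi * (2 * s + x) * h =
        Real.pi * x * (B - h) - 2 * Real.pi * s * h := by ring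
      rw [e1, e2, Real.sin_add, Real.sin_sub]
      field_simp
      ring
    rw [intervalIntegral.integral_eq_sub_of_hasDerivAt hd (Continuous.intervalIntegrable
      (by have := Real.continuous_sinc; fun_prop) _ _)]
    have e1 : Real.pi * x * B + Real.pi * (2 * s - x) * B =
        Real.pi * (B * (s + x / 2)) + Real.pi * (B * (s - x / 2)) := by ring
    have e2 : Real.pi * x * B - Real.pi * (2 * s + x) * B =
        -(Real.pi * (B * (s + x / 2)) + Real.pi * (B * (s - x / 2))) := by ring
    have e3 : Real.pi * x * B =
        Real.pi * (B * (s + x / 2)) - Real.pi * (B * (s - x / 2)) := by ring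
    rw [e1, e2, mul_zero, mul_zero, add_zero, sub_zero, e3, Real.cos_neg, Real.cos_add,
      Real.cos_sub]
    have hm' : s - x / 2 = (2 * s - x) / 2 := by ring
    have hp' : s + x / 2 = (2 * s + x) / 2 := by ring
    rw [hm', hp']
    field_simp
    ring

namespace Params

variable {p : Params}

theorem continuous_w₁ : Continuous p.w₁ := by
  have := continuous_nsinc
  unfold w₁; fun_prop

theorem w₁_neg (t : ℝ) : p.w₁ (-t) = p.w₁ t := by
  simp [w₁, mul_neg, nsinc_neg]

theorem w₂_neg (t : ℝ) : p.w₂ (-t) = p.w₂ t := by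
  simp [w₂, mul_neg, nsinc_neg]

theorem integrable_w₁ (hB : 0 < p.B) (hατ : 0 < p.ατ) : Integrable p.w₁ := by
  have h := (integrable_exp_neg_mul_sq (b := p.ατ * p.B ^ 2) (by positivity)).const_mul
    |p.Ωτ * Real.sqrt p.B|
  refine h.mono' continuous_w₁.aestronglyMeasurable (.of_forall fun t => ?_)
  rw [w₁, Real.norm_eq_abs, abs_mul, abs_mul _ (nsinc _), Real.abs_exp, neg_mul]
  exact mul_le_mul_of_nonneg_right
    (mul_le_of_le_one_right (abs_nonneg _) (abs_nsinc_le_one _)) (Real.exp_pos _).le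

theorem abs_w₁_le (hατ : 0 < p.ατ) (t : ℝ) : |p.w₁ t| ≤ |p.Ωτ * Real.sqrt p.B| := by
  rw [w₁, abs_mul, abs_mul _ (nsinc _), Real.abs_exp]
  have h1 : Real.exp (-(p.ατ * p.B ^ 2 * t ^ 2)) ≤ 1 := Real.exp_le_one_iff.2 (by
    have : 0 ≤ p.ατ * p.B ^ 2 * t ^ 2 := by positivity
    linarith)
  exact (mul_le_of_le_one_right (by positivity) h1).trans
    (mul_le_of_le_one_right (abs_nonneg _) (abs_nsinc_le_one _))

/-- The autocorrelation of the delay pulse depends only on the lag.  After centring, the two Gaussian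
factors combine into one in `s` and one in the lag; the product of the sinc factors is replaced by a
cosine transform, and the integral over `s` becomes that of a Gaussian. -/
theorem integral_w₁_mul_w₁ (hB : 0 < p.B) (hατ : 0 < p.ατ) (u₁ u₂ : ℝ) :
    ∫ t : ℝ, p.w₁ (u₁ - t) * p.w₁ (u₂ - t) =
      p.Ωτ ^ 2 * Real.sqrt (Real.pi / (2 * p.ατ)) / p.B ^ 2 *
        Real.exp (-(p.ατ * p.B ^ 2 / 2 * (u₂ - u₁) ^ 2)) * p.lagIntegral (u₂ - u₁) := by
  set x := u₂ - u₁ with hx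
  set b := 2 * p.ατ * p.B ^ 2 with hb
  have hb0 : 0 < b := by positivity
  set k : ℝ → ℝ := fun h => (p.B - h) * Real.sinc (Real.pi * x * (p.B - h)) with hk
  have hkc : Continuous k := by have := Real.continuous_sinc; fun_prop
  set A := p.Ωτ ^ 2 * p.B * Real.exp (-(p.ατ * p.B ^ 2 / 2 * x ^ 2)) * (2 / p.B ^ 2) with hA
  have hcentre : ∫ t : ℝ, p.w₁ (u₁ - t) * p.w₁ (u₂ - t) =
      ∫ s : ℝ, p.w₁ (s - x / 2) * p.w₁ (s + x / 2) := by
    rw [← integral_sub_left_eq_self (fun s => p.w₁ (s - x / 2) * p.w₁ (s + x / 2)) volume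
      ((u₁ + u₂) / 2)]
    congr 1
    funext t
    rw [hx]
    congr 2 <;> ring
  -- the representation of the product of sinc pulses fails only at `s = ± x / 2`
  have hae : (fun s : ℝ => p.w₁ (s - x / 2) * p.w₁ (s + x / 2)) =ᵐ[volume] fun s =>
      A * ∫ h in (0 : ℝ)..p.B,
        k h * (Real.cos (2 * Real.pi * s * h) * Real.exp (-(b * s ^ 2))) := by
    filter_upwards [Measure.ae_ne volume (x / 2), Measure.ae_ne volume (-(x / 2))] with s h1 h2
    have := nsinc_mul_nsinc hB (x := x) (s := s) (sub_ne_zero.2 h1)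
      (fun h => h2 (eq_neg_of_add_eq_zero_left h))
    have hi : ∀ h, k h * (Real.cos (2 * Real.pi * s * h) * Real.exp (-(b * s ^ 2))) =
        Real.cos (2 * Real.pi * s * h) * ((p.B - h) * Real.sinc (Real.pi * x * (p.B - h))) *
          Real.exp (-(b * s ^ 2)) := fun h => by rw [hk]; ring
    simp_rw [hi]
    rw [intervalIntegral.integral_mul_const]
    have hexp : Real.exp (-(p.ατ * p.B ^ 2 * (s - x / 2) ^ 2)) *
        Real.exp (-(p.ατ * p.B ^ 2 * (s + x / 2) ^ 2)) =
        Real.exp (-(p.ατ * p.B ^ 2 / 2 * x ^ 2)) * Real.exp (-(b * s ^ 2)) := by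
      rw [← Real.exp_add, ← Real.exp_add, hb]; congr 1; ring
    calc p.w₁ (s - x / 2) * p.w₁ (s + x / 2)
        = p.Ωτ ^ 2 * (Real.sqrt p.B * Real.sqrt p.B) *
          (nsinc (p.B * (s - x / 2)) * nsinc (p.B * (s + x / 2))) *
          (Real.exp (-(p.ατ * p.B ^ 2 * (s - x / 2) ^ 2)) *
            Real.exp (-(p.ατ * p.B ^ 2 * (s + x / 2) ^ 2))) := by rw [w₁, w₁]; ring
      _ = _ := by rw [this, hexp, Real.mul_self_sqrt hB.le, hA]; ring
  rw [hcentre, integral_congr_ae hae, integral_const_mul, ← intervalIntegral_integral_swap]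
  · have hin : ∀ h : ℝ, ∫ s : ℝ, k h * (Real.cos (2 * Real.pi * s * h) * Real.exp (-(b * s ^ 2))) =
        Real.sqrt (Real.pi / b) * (Real.exp (-(p.a₁ * h ^ 2)) * k h) := by
      intro h
      rw [integral_const_mul, integral_cos_mul_gaussian hb0, a₁, ← hb]; ring
    simp_rw [hin]
    have hlag : p.lagIntegral x = 2 * ∫ h in (0 : ℝ)..p.B, Real.exp (-(p.a₁ * h ^ 2)) * k h := rfl
    rw [intervalIntegral.integral_const_mul, hlag, hA]
    have : Real.sqrt (Real.pi / b) = Real.sqrt (Real.pi / (2 * p.ατ)) / p.B := by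
      rw [hb, ← div_div, Real.sqrt_div (by positivity), Real.sqrt_sq hB.le]
    rw [this]
    field_simp
  · have h1 : Integrable (fun z : ℝ × ℝ => k z.1 * Real.exp (-b * z.2 ^ 2))
        ((volume.restrict (Set.uIoc 0 p.B)).prod volume) :=
      Integrable.mul_prod (f := k) (hkc.intervalIntegrable 0 p.B).def'
        (integrable_exp_neg_mul_sq hb0)
    refine h1.mono ?_ (.of_forall fun z => ?_)
    · exact Continuous.aestronglyMeasurable (by fun_prop)
    · simp only [Function.uncurry, norm_mul, Real.norm_eq_abs, Real.abs_exp, neg_mul]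
      exact mul_le_mul_of_nonneg_left
        (mul_le_of_le_one_left (Real.exp_pos _).le (Real.abs_cos_le_one _)) (abs_nonneg _)

/-- The factor `S₁`, completed by `S₂` at lag zero, is `N₀` times the autocorrelation of the delay
pulse. -/
theorem S_eq_autocorrelation (hB : 0 < p.B) (hατ : 0 < p.ατ) (u₁ u₂ : ℝ) :
    (if u₂ - u₁ ≠ 0 then p.S₁ (u₂ - u₁) else p.S₂) =
      ((p.N₀ * ∫ t : ℝ, p.w₁ (u₁ - t) * p.w₁ (u₂ - t) : ℝ) : ℂ) := by
  rw [integral_w₁_mul_w₁ hB hατ]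
  split_ifs with h
  · exact S₁_eq_lagIntegral hB hατ h
  · have h0 : u₂ - u₁ = 0 := not_not.1 h
    rw [h0, S₂_eq_lagIntegral hB hατ]
    simp

end Params

/-! ### Trains of pulses -/

theorem integrable_tsum_of_summable_integral_norm {α ι E : Type*} [MeasurableSpace α]
    {μ : Measure α} [Countable ι] [NormedAddCommGroup E] {F : ι → α → E}
    (hF_int : ∀ i, Integrable (F i) μ) (hF_sum : Summable fun i => ∫ a, ‖F i a‖ ∂μ)
    (hm : AEStronglyMeasurable (fun a => ∑' i, F i a) μ) :
    Integrable (fun a => ∑' i, F i a) μ := by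
  refine ⟨hm, ?_⟩
  calc ∫⁻ a, ‖∑' i, F i a‖ₑ ∂μ ≤ ∫⁻ a, ∑' i, ‖F i a‖ₑ ∂μ :=
        lintegral_mono fun a => enorm_tsum_le_tsum_enorm
    _ = ∑' i, ∫⁻ a, ‖F i a‖ₑ ∂μ := lintegral_tsum fun i => (hF_int i).1.enorm
    _ = ∑' i, ENNReal.ofReal (∫ a, ‖F i a‖ ∂μ) := by
        simp_rw [ofReal_integral_norm_eq_lintegral_enorm (hF_int _)]
    _ < ⊤ := hF_sum.tsum_ofReal_lt_top

/-- The superposition `∑_q c q • w (u q - ·)` of time-reversed, delayed copies of the pulse `w`. -/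
noncomputable def pulseTrain (w : ℝ → ℝ) (c : ℤ → ℂ) (u : ℤ → ℝ) (t : ℝ) : ℂ :=
  ∑' q : ℤ, c q * (w (u q - t) : ℂ)

section PulseTrain

variable {w : ℝ → ℝ} {C : ℝ} {c d : ℤ → ℂ}

theorem norm_pulse_le (hC : ∀ t, |w t| ≤ C) (u : ℤ → ℝ) (t : ℝ) (q : ℤ) :
    ‖c q * (w (u q - t) : ℂ)‖ ≤ ‖c q‖ * C := by
  rw [norm_mul, Complex.norm_real]
  exact mul_le_mul_of_nonneg_left (hC _) (norm_nonneg _)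

theorem summable_norm_pulse (hC : ∀ t, |w t| ≤ C) (hc : Summable fun q => ‖c q‖)
    (u : ℤ → ℝ) (t : ℝ) : Summable fun q => ‖c q * (w (u q - t) : ℂ)‖ :=
  .of_nonneg_of_le (fun _ => norm_nonneg _) (norm_pulse_le hC u t) (hc.mul_right C)

theorem continuous_pulseTrain (hw : Continuous w) (hC : ∀ t, |w t| ≤ C)
    (hc : Summable fun q => ‖c q‖) (u : ℤ → ℝ) : Continuous (pulseTrain w c u) :=
  continuous_tsum (fun q => by fun_prop) (hc.mul_right C) fun q t => norm_pulse_le hC u t q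

theorem integrable_pulseTrain (hw : Continuous w) (hC : ∀ t, |w t| ≤ C) (hi : Integrable w)
    (hc : Summable fun q => ‖c q‖) (u : ℤ → ℝ) : Integrable (pulseTrain w c u) := by
  refine integrable_tsum_of_summable_integral_norm
    (fun q => ((hi.comp_sub_left (u q)).ofReal (𝕜 := ℂ)).const_mul (c q)) ?_
    (continuous_pulseTrain hw hC hc u).aestronglyMeasurable
  have : ∀ q, ∫ t : ℝ, ‖c q * (w (u q - t) : ℂ)‖ = ‖c q‖ * ∫ t, |w t| := by
    intro q
    simp_rw [norm_mul, Complex.norm_real, Real.norm_eq_abs]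
    rw [integral_const_mul, integral_sub_left_eq_self (fun t => |w t|)]
  simp_rw [this]
  exact hc.mul_right _

/-- A pulse train is bounded and integrable, hence square-integrable. -/
theorem memLp_two_pulseTrain (hw : Continuous w) (hC : ∀ t, |w t| ≤ C) (hi : Integrable w)
    (hc : Summable fun q => ‖c q‖) (u : ℤ → ℝ) : MemLp (pulseTrain w c u) 2 volume := by
  have hφc := continuous_pulseTrain hw hC hc u
  rw [memLp_two_iff_integrable_sq_norm hφc.aestronglyMeasurable]
  refine ((integrable_pulseTrain hw hC hi hc u).norm.const_mul (∑' q, ‖c q‖ * C)).mono'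
    (by fun_prop) (.of_forall fun t => ?_)
  rw [Real.norm_of_nonneg (by positivity), sq]
  exact mul_le_mul_of_nonneg_right (tsum_of_norm_bounded (hc.mul_right C).hasSum
    (norm_pulse_le hC u t)) (norm_nonneg _)

/-- The inner product of two pulse trains is the absolutely convergent double sum of the inner
products of their pulses. -/
theorem hasSum_integral_pulseTrain_mul_conj (hw : Continuous w) (hC : ∀ t, |w t| ≤ C)
    (hi : Integrable w) (hc : Summable fun q => ‖c q‖) (hd : Summable fun q => ‖d q‖)
    (u v : ℤ → ℝ) :
    HasSum (fun q : ℤ × ℤ => c q.1 * conj (d q.2) *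
        ((∫ t : ℝ, w (u q.1 - t) * w (v q.2 - t) : ℝ) : ℂ))
      (∫ t : ℝ, pulseTrain w c u t * conj (pulseTrain w d v t)) := by
  set F : ℤ × ℤ → ℝ → ℂ := fun q t =>
    (c q.1 * (w (u q.1 - t) : ℂ)) * conj (d q.2 * (w (v q.2 - t) : ℂ)) with hF
  have hF_eq : ∀ q t, F q t =
      c q.1 * conj (d q.2) * ((w (u q.1 - t) * w (v q.2 - t) : ℝ) : ℂ) := by
    intro q t
    simp only [hF, map_mul, Complex.conj_ofReal]
    push_cast
    ring
  have hprod : ∀ a b : ℝ, Integrable fun t : ℝ => w (a - t) * w (b - t) := fun a b =>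
    (hi.comp_sub_left b).bdd_mul (c := C) (by fun_prop) (.of_forall fun t => hC _)
  have hsum : ∀ t, pulseTrain w c u t * conj (pulseTrain w d v t) = ∑' q, F q t := by
    intro t
    have hconj : Summable fun q => ‖conj (d q * (w (v q - t) : ℂ))‖ := by
      simpa only [RCLike.norm_conj] using summable_norm_pulse hC hd v t
    rw [pulseTrain, pulseTrain, conj_tsum,
      tsum_mul_tsum_of_summable_norm (summable_norm_pulse hC hc u t) hconj]
  have hval : ∀ q, ∫ t : ℝ, F q t = c q.1 * conj (d q.2) *
      ((∫ t : ℝ, w (u q.1 - t) * w (v q.2 - t) : ℝ) : ℂ) := by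
    intro q
    simp_rw [hF_eq]
    rw [integral_const_mul, integral_complex_ofReal]
  have hFi : ∀ q, Integrable (F q) := by
    intro q
    rw [show F q = _ from funext (hF_eq q)]
    exact ((hprod _ _).ofReal (𝕜 := ℂ)).const_mul _
  simp_rw [hsum, ← hval]
  refine hasSum_integral_of_summable_integral_norm hFi ?_
  refine Summable.of_nonneg_of_le (fun q => integral_nonneg fun t => norm_nonneg _) (fun q => ?_)
    ((hc.mul_of_nonneg hd (fun _ => norm_nonneg _) (fun _ => norm_nonneg _)).mul_right
      (C * ∫ t, |w t|))
  have hle : ∫ t : ℝ, ‖F q t‖ ≤ ∫ t : ℝ, ‖c q.1‖ * ‖d q.2‖ * (C * |w (v q.2 - t)|) := by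
    refine integral_mono (hFi q).norm (((hi.comp_sub_left _).abs.const_mul C).const_mul _)
      fun t => ?_
    simp only [hF_eq, norm_mul, RCLike.norm_conj, Complex.norm_real, Real.norm_eq_abs]
    gcongr
    exact hC _
  refine hle.trans (le_of_eq ?_)
  rw [integral_const_mul, integral_const_mul, integral_sub_left_eq_self (fun t => |w t|)]

end PulseTrain

/-! ### The filtered noise -/

/-- Gaussian laws have finite second moments. -/
theorem IsWhiteNoise.memLp_two {Ω : Type*} [MeasurableSpace Ω] {P : Measure Ω} {N₀ : ℝ}
    {n : (ℝ → ℂ) → Ω → ℂ} (hn : IsWhiteNoise P N₀ n) {φ : ℝ → ℂ} (hφ : MemLp φ 2 volume) :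
    MemLp (n φ) 2 P :=
  (hn.gaussian.hasGaussianLaw_eval ⟨φ, hφ⟩).memLp_two

namespace Params

variable {p : Params}

theorem wrx_apply (τ ν : ℝ) : p.wrx τ ν = (p.w₁ τ : ℂ) * (p.w₂ ν : ℂ) * cis (ν * τ) := by
  simp [wrx, matchedFilter, wtx, w₁_neg, w₂_neg]

/-- The test function against which the white noise is evaluated in a sample of the filtered
delay-Doppler noise is a train of delay pulses weighted by `g`. -/
theorem zakTranspose_twistedKernel_wrx (hT : 0 < p.T) (hαν : 0 < p.αν) (τ ν : ℝ) :
    zakTranspose p.τp (twistedKernel p.wrx τ ν) = fun t => (Real.sqrt p.τp : ℂ) *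
      pulseTrain p.w₁ (fun q => cis (-(ν * q * p.τp)) * p.g (τ + q * p.τp))
        (fun q => τ + q * p.τp) t := by
  funext t
  rw [zakTranspose, pulseTrain]
  congr 2
  funext q
  rw [← integral_w₂_mul_cis hT hαν, mul_right_comm, ← integral_const_mul,
    ← integral_sub_left_eq_self _ volume ν]
  congr 1
  funext μ
  have h1 : τ - (t - q * p.τp) = τ + q * p.τp - t := by ring
  -- the phases of the filter, of the twisted convolution and of the Zak transform combine
  have hph : cis (μ * (τ + q * p.τp - t)) * cis (μ * (t - q * p.τp)) *
      cis (-((ν - μ) * q * p.τp)) = cis (-(ν * q * p.τp)) * cis (μ * (τ + q * p.τp)) := by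
    rw [← cis_add, ← cis_add, ← cis_add]
    congr 1
    ring
  rw [twistedKernel, wrx_apply, h1, sub_sub_cancel]
  linear_combination ((p.w₁ (τ + q * p.τp - t) : ℂ) * (p.w₂ μ : ℂ)) * hph

theorem summable_norm_cis_mul_g (hT : 0 < p.T) (hτp : 0 < p.τp) (hαν : 0 < p.αν) (τ ν : ℝ) :
    Summable fun q : ℤ => ‖cis (-(ν * q * p.τp)) * p.g (τ + q * p.τp)‖ := by
  simpa only [norm_mul, norm_cis, one_mul] using summable_norm_g hT hτp hαν τ

theorem memLp_two_zakTranspose (hB : 0 < p.B) (hT : 0 < p.T) (hτp : 0 < p.τp) (hατ : 0 < p.ατ)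
    (hαν : 0 < p.αν) (τ ν : ℝ) :
    MemLp (zakTranspose p.τp (twistedKernel p.wrx τ ν)) 2 volume := by
  rw [zakTranspose_twistedKernel_wrx hT hαν]
  exact (memLp_two_pulseTrain continuous_w₁ (abs_w₁_le hατ) (integrable_w₁ hB hατ)
    (summable_norm_cis_mul_g hT hτp hαν τ ν) _).const_mul _

section Noise

variable {Ω : Type*} [MeasurableSpace Ω] {P : Measure Ω} {n : (ℝ → ℂ) → Ω → ℂ}

theorem integrable_ndd_mul_conj (hB : 0 < p.B) (hT : 0 < p.T) (hτp : 0 < p.τp) (hατ : 0 < p.ατ)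
    (hαν : 0 < p.αν) (hn : IsWhiteNoise P p.N₀ n) (k₁ l₁ k₂ l₂ : ℤ) :
    Integrable (fun ω => p.ndd n k₁ l₁ ω * conj (p.ndd n k₂ l₂ ω)) P :=
  (hn.memLp_two (memLp_two_zakTranspose hB hT hτp hατ hαν _ _)).integrable_mul
    (hn.memLp_two (memLp_two_zakTranspose hB hT hτp hατ hαν _ _)).star

/-- The covariance of two noise samples is `N₀` times the inner product of their pulse trains; the
phases, the values of `g` and the pulse autocorrelations assemble into the terms of the double
series. -/
theorem hasSum_covTerm (hB : 0 < p.B) (hT : 0 < p.T) (hτp : 0 < p.τp) (hατ : 0 < p.ατ)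
    (hαν : 0 < p.αν) (hn : IsWhiteNoise P p.N₀ n) (k₁ l₁ k₂ l₂ : ℤ) :
    HasSum (p.covTerm k₁ l₁ k₂ l₂)
      (∫ ω, p.ndd n k₁ l₁ ω * conj (p.ndd n k₂ l₂ ω) ∂P) := by
  have hcov := hn.cov _ _
    (memLp_two_zakTranspose hB hT hτp hατ hαν (k₁ * p.τp / p.M) (l₁ * p.νp / p.N))
    (memLp_two_zakTranspose hB hT hτp hατ hαν (k₂ * p.τp / p.M) (l₂ * p.νp / p.N))
  have hS := hasSum_integral_pulseTrain_mul_conj continuous_w₁ (abs_w₁_le hατ)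
    (integrable_w₁ hB hατ)
    (summable_norm_cis_mul_g hT hτp hαν (k₁ * p.τp / p.M) (l₁ * p.νp / p.N))
    (summable_norm_cis_mul_g hT hτp hαν (k₂ * p.τp / p.M) (l₂ * p.νp / p.N))
    (fun q => k₁ * p.τp / p.M + q * p.τp) (fun q => k₂ * p.τp / p.M + q * p.τp)
  have hsq : (Real.sqrt p.τp : ℂ) * Real.sqrt p.τp = p.τp := by
    rw [← Complex.ofReal_mul, Real.mul_self_sqrt hτp.le]
  have hphase : ∀ (l q : ℤ), l * p.νp / p.N * q * p.τp = q * l / p.N := by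
    intro l q
    rw [νp]
    field_simp
  rw [zakTranspose_twistedKernel_wrx hT hαν, zakTranspose_twistedKernel_wrx hT hαν] at hcov
  unfold ndd filteredNoise
  rw [zakTranspose_twistedKernel_wrx hT hαν, zakTranspose_twistedKernel_wrx hT hαν, hcov]
  simp only [map_mul, Complex.conj_ofReal]
  simp_rw [mul_mul_mul_comm _ _ (Real.sqrt p.τp : ℂ) _, hsq]
  rw [integral_const_mul, ← mul_assoc]
  refine (hS.mul_left ((p.N₀ : ℂ) * p.τp)).congr_fun fun q => ?_
  have hx : p.x k₁ k₂ q.1 q.2 =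
      (k₂ * p.τp / p.M + q.2 * p.τp) - (k₁ * p.τp / p.M + q.1 * p.τp) := by
    rw [x]; ring
  have hcis : cis (((q.2 : ℝ) * l₂ - q.1 * l₁) / p.N) =
      cis (-(l₁ * p.νp / p.N * q.1 * p.τp)) * conj (cis (-(l₂ * p.νp / p.N * q.2 * p.τp))) := by
    rw [← cis_neg, ← cis_add, hphase, hphase]
    congr 1
    ring
  rw [covTerm, hx, S_eq_autocorrelation hB hατ, hcis, map_mul]
  push_cast
  ring

end Noise

end Params
end ZakOTFS

theorem theorem2 {Ω : Type*} [MeasurableSpace Ω] (P : Measure Ω) [IsProbabilityMeasure P]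
    (p : ZakOTFS.Params) (hM : 0 < p.M) (hN : 0 < p.N) (hτp : 0 < p.τp)
    (hατ : 0 < p.ατ) (hαν : 0 < p.αν) (hN₀ : 0 < p.N₀)
    -- energy normalization of the two pulses
    (hΩτ : 0 < p.Ωτ) (hw₁ : ∫ τ : ℝ, |p.w₁ τ| ^ 2 = 1)
    (hΩν : 0 < p.Ων) (hw₂ : ∫ ν : ℝ, |p.w₂ ν| ^ 2 = 1)
    (n : (ℝ → ℂ) → Ω → ℂ) (hn : ZakOTFS.IsWhiteNoise P p.N₀ n)
    (k₁ k₂ : Fin p.M) (l₁ l₂ : Fin p.N) :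
    -- the expectation exists and is the corresponding entry of the covariance matrix
    Integrable (fun ω => p.ndd n (k₁ : ℕ) (l₁ : ℕ) ω * conj (p.ndd n (k₂ : ℕ) (l₂ : ℕ) ω)) P ∧
    p.noiseCov P n (finProdFinEquiv (k₁, l₁)) (finProdFinEquiv (k₂, l₂)) =
      ∫ ω, p.ndd n (k₁ : ℕ) (l₁ : ℕ) ω * conj (p.ndd n (k₂ : ℕ) (l₂ : ℕ) ω) ∂P ∧
    -- it is the sum of the (absolutely convergent) double series
    HasSum (p.covTerm (k₁ : ℕ) (l₁ : ℕ) (k₂ : ℕ) (l₂ : ℕ))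
      (∫ ω, p.ndd n (k₁ : ℕ) (l₁ : ℕ) ω * conj (p.ndd n (k₂ : ℕ) (l₂ : ℕ) ω) ∂P) := by
  have hB := ZakOTFS.Params.B_pos hM hτp
  have hT := ZakOTFS.Params.T_pos hN hτp
  refine ⟨ZakOTFS.Params.integrable_ndd_mul_conj hB hT hτp hατ hαν hn _ _ _ _, ?_,
    ZakOTFS.Params.hasSum_covTerm hB hT hτp hατ hαν hn _ _ _ _⟩
  simp only [ZakOTFS.Params.noiseCov, ZakOTFS.Params.noiseVector, Matrix.of_apply,
    Equiv.symm_apply_apply]
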